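/- **Model.** There are $k$ peers, pairwise connected, with identities $1,\dots,k$, and a trusted source that stores an input $X\in\{0,1\}^n$, where $2\le k\le n$. Computation proceeds in synchronous rounds. In each round every peer generates private independent fair random bits, queries the source for any set of indices $i$ and receives the corresponding bits $X_i$, and then sends to each other peer at most one message (a bit string; different recipients may get different messages), which is delivered in the same round together with the identity of its sender. A peer may terminate with an output in $\{0,1\}^n$, after which it neither queries nor sends. Let $\beta\in[0,1)$ and $\gamma=1-\beta$; both are known to the peers. A *fixed adaptive Byzantine adversary* knows the protocol and $X$; at the start of each round, knowing all random bits generated and all communication in the previous rounds, it may corrupt further peers, at most $\beta k$ in total, and it decides on the messages that the corrupted peers send in this round. Corrupted peers stay corrupted. A peer is *nonfaulty* if it is never corrupted during the execution, which ends at the first time at which all peers not corrupted so far have terminated. For an execution, $\mathcal Q$ is the maximal number of bits queried by a nonfaulty peer, $\mathcal T$ the number of rounds, and $\mathcal M$ the total number of messages sent by nonfaulty peers. *Download* is solved if every nonfaulty peer outputs $X$. **Theorem.** There is an absolute constant $S$, and for every $c\ge 1$ there is a constant $C>0$ that depends only on $c$, such that for all integers $n\ge k\ge 2$ and every real $\beta\in[0,1)$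 there is a randomized protocol with the following property. For every input $X\in\{0,1\}^n$ and every fixed adaptive Byzantine adversary that corrupts at most $\beta k$ peers, no nonfaulty peer ever sends a message of more than $S$ bits, and with probability at least $1-n^{-c}$ the execution terminates, solves Download, and satisfies $$\mathcal Q\le C\,\frac{n\log_2 n}{\gamma k},\qquad \mathcal T\le C\,n\log_2 k,\qquad \mathcal M\le C\,nk^2 .$$ -/

import Mathlib

noncomputable section

namespace DataRetrieval

/-- Messages are bit strings; the size of a message is its length. -/
abbrev Msg := List Bool

/-- The random bits generated in one round: `b` fair bits by each of the `k` peers. -/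
abbrev RoundBits (k b : ℕ) := Fin k → Fin b → Bool

/-- The random bits of a whole (infinite) execution, round by round. -/
abbrev Tape (k b : ℕ) := ℕ → RoundBits k b

/-- All random bits are independent and fair. -/
def tapeMeasure (k b : ℕ) : MeasureTheory.Measure (Tape k b) :=
  MeasureTheory.Measure.infinitePi
    (fun _ : ℕ => (PMF.uniformOfFintype (RoundBits k b)).toMeasure)

/-- A randomized protocol for `k` peers and a source with `n` bits, as a family of local state
machines. In each round a peer generates `bits` private random bits, sends queries to the
source, receives the answers (`none` at the indices that it did not query), then sends at most
one message to every other peer, possibly different ones, and updates its state from the messages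
that it receives (`none` if no message came from that peer). Once `output` is defined on its
state the peer has terminated. -/
structure Protocol (n k : ℕ) where
  State : Type
  bits : ℕ
  init : Fin k → State
  query : Fin k → State → (Fin bits → Bool) → Finset (Fin n)
  send : Fin k → State → (Fin bits → Bool) → (Fin n → Option Bool) → Fin k → Option Msg
  next : Fin k → State → (Fin bits → Bool) → (Fin n → Option Bool) → (Fin k → Option Msg) → State
  output : State → Option (Fin n → Bool)

/-- A fixed, adaptive Byzantine adversary with corruption budget `β * k`. At the start of round
`t` it chooses the set of corrupted peers and the messages (`forge t h p q` from `p` to `q`) that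
corrupted peers send in this round. It acts on all random bits `h` generated by all peers in the
rounds before `t`. It is quantified after the protocol and the input, so it knows both, and with
them `h` determines all states, queries, answers and messages of the rounds before `t`. -/
structure Adversary (k b : ℕ) (β : ℝ) where
  corrupt : (t : ℕ) → (Fin t → RoundBits k b) → Finset (Fin k)
  forge : (t : ℕ) → (Fin t → RoundBits k b) → Fin k → Fin k → Option Msg
  /-- A corrupted peer remains corrupted. -/
  fixed : ∀ (t : ℕ) (h : Fin (t + 1) → RoundBits k b),
    corrupt t (fun s => h s.castSucc) ⊆ corrupt (t + 1) h
  budget : ∀ (t : ℕ) (h : Fin t → RoundBits k b), ((corrupt t h).card : ℝ) ≤ β * k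

/-- The random bits of the rounds before `t`. -/
def history {k b : ℕ} (ω : Tape k b) (t : ℕ) : Fin t → RoundBits k b := fun s => ω s

/-- The peers that are corrupted in at least one of the first `t` rounds. -/
def Adversary.faulty {k b : ℕ} {β : ℝ} (A : Adversary k b β) (ω : Tape k b) (t : ℕ) :
    Finset (Fin k) :=
  (Finset.range t).biUnion fun s => A.corrupt s (history ω s)

/-- The answers of the source with content `X` to the queries for the indices in `I`. -/
def answers {n : ℕ} (X : Fin n → Bool) (I : Finset (Fin n)) : Fin n → Option Bool :=
  fun i => if i ∈ I then some (X i) else none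

/-- The states of all peers, together with the number of bits that each peer has queried, the
number of messages that it has sent, and the maximal size of a message that it has sent. (The
entries of corrupted peers are never used.) -/
structure Config (n k : ℕ) (σ : Type) where
  state : Fin k → σ
  queries : Fin k → ℕ
  messages : Fin k → ℕ
  maxSize : Fin k → ℕ

namespace Protocol

variable {n k : ℕ} (P : Protocol n k)

/-- The queries of peer `p` in state `s` with random bits `r`; none after termination. -/
def queriesOf (p : Fin k) (s : P.State) (r : Fin P.bits → Bool) : Finset (Fin n) :=
  if (P.output s).isSome then ∅ else P.query p s r

/-- The message that a peer `p` following the protocol sends to peer `q`; none after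
termination. -/
def sendOf (X : Fin n → Bool) (p : Fin k) (s : P.State) (r : Fin P.bits → Bool) (q : Fin k) :
    Option Msg :=
  if (P.output s).isSome then none else P.send p s r (answers X (P.queriesOf p s r)) q

/-- The message sent from `p` to `q` in a round with corrupted set `B`. -/
def sent (X : Fin n → Bool) (B : Finset (Fin k)) (forged : Fin k → Fin k → Option Msg)
    (r : RoundBits k P.bits) (state : Fin k → P.State) (p q : Fin k) : Option Msg :=
  if p = q then none
  else if p ∈ B then forged p q
  else P.sendOf X p (state p) (r p) q

/-- One synchronous round. The states of terminated (and of corrupted) peers do not change. -/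
def step (X : Fin n → Bool) (B : Finset (Fin k)) (forged : Fin k → Fin k → Option Msg)
    (r : RoundBits k P.bits) (c : Config n k P.State) : Config n k P.State where
  state p :=
    if p ∈ B ∨ (P.output (c.state p)).isSome then c.state p
    else P.next p (c.state p) (r p) (answers X (P.queriesOf p (c.state p) (r p)))
      (fun q => P.sent X B forged r c.state q p)
  queries p := c.queries p + (P.queriesOf p (c.state p) (r p)).card
  messages p := c.messages p +
    (Finset.univ.filter fun q => (P.sent X B forged r c.state p q).isSome).card
  maxSize p := max (c.maxSize p)
    (Finset.univ.sup fun q => ((P.sent X B forged r c.state p q).getD []).length)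

/-- The configuration after `t` rounds of the execution on input `X`, against `A`, with random
bits `ω`. Rounds are numbered from `0`. -/
def run (X : Fin n → Bool) {β : ℝ} (A : Adversary k P.bits β) (ω : Tape k P.bits) :
    ℕ → Config n k P.State
  | 0 => ⟨P.init, fun _ => 0, fun _ => 0, fun _ => 0⟩
  | t + 1 => P.step X (A.corrupt t (history ω t)) (A.forge t (history ω t)) (ω t) (run X A ω t)

/-- After `t` rounds every nonfaulty peer has terminated. -/
def Terminated (X : Fin n → Bool) {β : ℝ} (A : Adversary k P.bits β) (ω : Tape k P.bits)
    (t : ℕ) : Prop :=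
  ∀ p ∉ A.faulty ω t, (P.output ((P.run X A ω t).state p)).isSome

/-- The execution terminates, with every nonfaulty peer holding the whole input `X`, and has query
complexity at most `Q`, round complexity at most `T` and message complexity at most `M`. -/
def DownloadsWithin (X : Fin n → Bool) {β : ℝ} (A : Adversary k P.bits β) (ω : Tape k P.bits)
    (Q T M : ℝ) : Prop :=
  ∃ t : ℕ, IsLeast {t | P.Terminated X A ω t} t ∧
    (∀ p ∉ A.faulty ω t, P.output ((P.run X A ω t).state p) = some X) ∧
    (∀ p ∉ A.faulty ω t, ((P.run X A ω t).queries p : ℝ) ≤ Q) ∧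
    (t : ℝ) ≤ T ∧
    ((∑ p ∈ (A.faulty ω t)ᶜ, (P.run X A ω t).messages p : ℕ) : ℝ) ≤ M

/-- In every execution against `A` on input `X`, every message that is sent by a peer which is
nonfaulty up to and including that round has at most `S` bits. -/
def MessageSizeAtMost (X : Fin n → Bool) {β : ℝ} (A : Adversary k P.bits β) (S : ℕ) : Prop :=
  ∀ (ω : Tape k P.bits) (t : ℕ), ∀ p ∉ A.faulty ω t, (P.run X A ω t).maxSize p ≤ S

end Protocol

end DataRetrieval

end

/-! The input bits are settled one after another, each in b + 1 phases of one round. In phase j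
every coin shows up with probability 2^j/2^b. A peer whose coin shows up queries the current bit if
it does not know it, and sends its value to everyone if it has not voted on it yet.

Correctness. At least g = (1-β)k peers are uncorrupted, and the corrupted set of a round is fixed
before its coins are tossed. The threshold `θ j` is half of g 2^j/2^b, rounded up, so by a Chernoff
bound the true value has `θ j` votes with high probability (`tapeMeasure_not_enoughVotes_le`). A
value with fewer votes is therefore wrong and the other one right (`sound_succ`). If both values
reach the threshold, the peer stays undecided and the next phase doubles the coin probability. In
the last phase all coins show up, so every bit gets settled.

Queries. If a bit is still open after phase j, both values have `θ j` votes, and all voters for the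
value that loses are blacklisted when the bit is closed. The query probabilities of the phases up to
j + 1 form a geometric sum below 2·2^(j+1)/2^b, at most K `θ j` with K = 8/g. A peer is blacklisted
only once, so these phases cost at most Kk in total, while phase 0 costs 1/2^b per bit
(`VoteState.Paid.next`, `sum_queryRate_le`). This bounds the sum of the conditional query
probabilities in every execution. The actual count follows from the supermartingale 2^queries ·
exp(-sum of rates) (`tapeMeasure_queries_gt_le`).

Finally 2^b is taken of order g/log n: small enough for the Chernoff bound, large enough for n/2^b
to be O(n log n/g). -/

noncomputable section

namespace DataRetrieval

/-! ### Random bits: conditional Markov inequality and coins -/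

section Tape

variable {k b : ℕ}

/-- The first `N` rounds of random bits are uniformly distributed. -/
theorem tapeMeasure_history_eq {N : ℕ} (h : Fin N → RoundBits k b) :
    tapeMeasure k b {ω | history ω N = h} = ((Fintype.card (RoundBits k b) : ENNReal)⁻¹) ^ N := by
  classical
  have hset : {ω : Tape k b | history ω N = h} =
      Set.pi (Finset.range N) (fun s => if hs : s < N then {h ⟨s, hs⟩} else Set.univ) := by
    ext ω
    simp only [Set.mem_ofPred_eq, Set.mem_pi, Finset.coe_range, Set.mem_Iio]
    constructor
    · intro H s hs
      simp only [hs, dif_pos, Set.mem_singleton_iff]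
      exact congrFun H ⟨s, hs⟩
    · intro H
      funext s
      simpa [history] using H s s.2
  rw [hset, tapeMeasure, MeasureTheory.Measure.infinitePi_pi]
  · rw [Finset.prod_congr rfl (g := fun _ => (Fintype.card (RoundBits k b) : ENNReal)⁻¹)]
    · simp
    · intro s hs
      rw [dif_pos (Finset.mem_range.1 hs), PMF.toMeasure_apply_singleton _ _ (measurableSet_singleton _),
        PMF.uniformOfFintype_apply]
  · intro s _
    split_ifs
    · exact measurableSet_singleton _
    · exact MeasurableSet.univ

/-- If every factor has mean at most one given the past, then so has the product. -/
theorem sum_prod_le_card_pow (g : (t : ℕ) → (Fin t → RoundBits k b) → RoundBits k b → ℝ)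
    (hg0 : ∀ t h r, 0 ≤ g t h r)
    (hg : ∀ t h, ∑ r, g t h r ≤ Fintype.card (RoundBits k b)) (N : ℕ) :
    ∑ h : Fin N → RoundBits k b, ∏ t : Fin N, g t (fun s => h (s.castLE t.2.le)) (h t) ≤
      (Fintype.card (RoundBits k b) : ℝ) ^ N := by
  induction N with
  | zero => simp
  | succ N ih =>
    -- Only the last factor depends on the bits of the last round, so these are summed out first,
    -- with the past held fixed.
    rw [← (Fin.snocEquiv (fun _ : Fin (N + 1) => RoundBits k b)).sum_comp, Fintype.sum_prod_type,
      Finset.sum_comm]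
    calc _ = ∑ h : Fin N → RoundBits k b,
          (∏ t : Fin N, g t (fun s => h (s.castLE t.2.le)) (h t)) * ∑ r, g N h r := by
          refine Finset.sum_congr rfl fun h _ => ?_
          rw [Finset.mul_sum]
          refine Finset.sum_congr rfl fun r _ => ?_
          rw [Fin.prod_univ_castSucc]
          congr 1
          · refine Finset.prod_congr rfl fun t _ => ?_
            simp only [Fin.snocEquiv, Equiv.coe_fn_mk, Fin.snoc_castSucc]
            congr 1
            funext s
            exact Fin.snoc_castSucc (α := fun _ => RoundBits k b) r h (s.castLE t.2.le)
          · simp only [Fin.snocEquiv, Equiv.coe_fn_mk, Fin.snoc_last]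
            congr 1
            funext s
            exact Fin.snoc_castSucc (α := fun _ => RoundBits k b) r h s
      _ ≤ ∑ h : Fin N → RoundBits k b,
          (∏ t : Fin N, g t (fun s => h (s.castLE t.2.le)) (h t)) *
            Fintype.card (RoundBits k b) := by
          gcongr with h
          · exact Finset.prod_nonneg fun _ _ => hg0 _ _ _
          · exact hg _ _
      _ ≤ _ := by
          rw [← Finset.sum_mul, pow_succ]
          gcongr

/-- Markov's inequality for a product of factors with conditional mean at most one. -/
theorem tapeMeasure_le_prod_le (g : (t : ℕ) → (Fin t → RoundBits k b) → RoundBits k b → ℝ)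
    (hg0 : ∀ t h r, 0 ≤ g t h r)
    (hg : ∀ t h, ∑ r, g t h r ≤ Fintype.card (RoundBits k b)) (N : ℕ) {y : ℝ} (hy : 0 < y) :
    tapeMeasure k b {ω | y ≤ ∏ t ∈ Finset.range N, g t (history ω t) (ω t)} ≤
      ENNReal.ofReal y⁻¹ := by
  classical
  let F : (Fin N → RoundBits k b) → ℝ :=
    fun h => ∏ t : Fin N, g t (fun s => h (s.castLE t.2.le)) (h t)
  have hF0 : ∀ h, 0 ≤ F h := fun h => Finset.prod_nonneg fun _ _ => hg0 _ _ _
  let T : Finset (Fin N → RoundBits k b) := Finset.univ.filter fun h => y ≤ F h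
  set R : ℕ := Fintype.card (RoundBits k b) with hR
  have hRpos : 0 < (R : ℝ) := by exact_mod_cast Fintype.card_pos
  -- The event depends on finitely many rounds only, hence is covered by equiprobable cylinders; it
  -- remains to count them.
  have hsub : {ω : Tape k b | y ≤ ∏ t ∈ Finset.range N, g t (history ω t) (ω t)} ⊆
      ⋃ h ∈ T, {ω | history ω N = h} := by
    intro ω hω
    simp only [Set.mem_iUnion, Set.mem_ofPred_eq, exists_prop, exists_eq_right', T,
      Finset.mem_filter, Finset.mem_univ, true_and]
    rw [Set.mem_ofPred_eq, Finset.prod_range] at hω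
    exact hω
  have hcard : (T.card : ℝ) * y ≤ (R : ℝ) ^ N := by
    calc (T.card : ℝ) * y = ∑ _h ∈ T, y := by simp
      _ ≤ ∑ h ∈ T, F h := Finset.sum_le_sum fun h hh => (Finset.mem_filter.1 hh).2
      _ ≤ ∑ h, F h := Finset.sum_le_sum_of_subset_of_nonneg (Finset.subset_univ _)
          fun h _ _ => hF0 h
      _ ≤ _ := sum_prod_le_card_pow g hg0 hg N
  calc _ ≤ tapeMeasure k b (⋃ h ∈ T, {ω | history ω N = h}) := MeasureTheory.measure_mono hsub
    _ ≤ ∑ h ∈ T, tapeMeasure k b {ω | history ω N = h} :=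
        MeasureTheory.measure_biUnion_finset_le _ _
    _ = (T.card : ENNReal) * ((R : ENNReal)⁻¹) ^ N := by
        simp [tapeMeasure_history_eq, hR]
    _ = ENNReal.ofReal (T.card * ((R : ℝ)⁻¹) ^ N) := by
        rw [ENNReal.ofReal_mul (by positivity), ENNReal.ofReal_pow (by positivity),
          ENNReal.ofReal_inv_of_pos hRpos, ENNReal.ofReal_natCast, ENNReal.ofReal_natCast]
    _ ≤ _ := by
        apply ENNReal.ofReal_le_ofReal
        rw [inv_pow, ← div_eq_mul_inv, div_le_iff₀ (by positivity), ← div_eq_inv_mul,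
          le_div_iff₀ hy]
        exact hcard

/-- Private bits are independent: the mean of a product over the peers factorizes. -/
theorem sum_roundBits_prod_le (g : Fin k → (Fin b → Bool) → ℝ) (m : Fin k → ℝ)
    (hg0 : ∀ p x, 0 ≤ g p x) (hg : ∀ p, ∑ x, g p x ≤ 2 ^ b * m p) :
    ∑ r : RoundBits k b, ∏ p, g p (r p) ≤ Fintype.card (RoundBits k b) * ∏ p, m p := by
  have h := Finset.prod_univ_sum (fun _ : Fin k => (Finset.univ : Finset (Fin b → Bool))) g
  rw [Fintype.piFinset_univ] at h
  rw [← h]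
  calc _ ≤ ∏ p : Fin k, (2 ^ b * m p) :=
        Finset.prod_le_prod (fun p _ => Finset.sum_nonneg fun x _ => hg0 p x) fun p _ => hg p
    _ = _ := by
        rw [Finset.prod_mul_distrib]
        simp

/-- The coin of phase `j`: all private bits with index at least `j` are set. -/
def coin (j : ℕ) (r : Fin b → Bool) : Bool := decide (∀ l : Fin b, j ≤ l → r l = true)

theorem coin_self (r : Fin b → Bool) : coin b r = true := by
  simp only [coin, decide_eq_true_eq]
  intro l hl
  exact absurd l.2 (not_lt.2 hl)

theorem card_coin {j : ℕ} (hj : j ≤ b) :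
    (Finset.univ.filter fun r : Fin b → Bool => coin j r = true).card = 2 ^ j := by
  classical
  have h : (Finset.univ.filter fun r : Fin b → Bool => coin j r = true) =
      Fintype.piFinset fun l : Fin b => if j ≤ l then {true} else Finset.univ := by
    ext r
    simp only [coin, decide_eq_true_eq, Finset.mem_filter, Finset.mem_univ, true_and,
      Fintype.mem_piFinset]
    refine forall_congr' fun l => ?_
    by_cases hl : j ≤ l <;> simp [hl]
  rw [h, Fintype.card_piFinset]
  calc _ = ∏ l : Fin b, (if (l : ℕ) < j then 2 else 1) := by
        refine Finset.prod_congr rfl fun l _ => ?_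
        by_cases hl : j ≤ l
        · simp [hl, not_lt.2 hl]
        · simp [hl, not_le.1 hl]
    _ = 2 ^ j := by
        rw [Fin.prod_univ_eq_prod_range (fun l => if l < j then 2 else 1) b, Finset.prod_ite]
        simp only [Finset.prod_const, one_pow, mul_one]
        congr 1
        rw [show (Finset.range b).filter (fun l => l < j) = Finset.range j by
          ext l; simp; omega]
        simp

/-- The mean of a function of the coin of phase `j`. -/
theorem sum_coin {j : ℕ} (hj : j ≤ b) (u : ℝ) :
    ∑ r : Fin b → Bool, (if coin j r = true then 1 + u else 1) =
      2 ^ b * (1 + u * (2 ^ j / 2 ^ b)) := by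
  have h : ∀ r : Fin b → Bool, (if coin j r = true then 1 + u else (1 : ℝ)) =
      1 + if coin j r = true then u else 0 := by intro r; split_ifs <;> simp
  simp only [h, Finset.sum_add_distrib, ← Finset.sum_filter, Finset.sum_const, card_coin hj]
  simp
  field_simp

end Tape

/-! ### Local rules of the voting protocol -/

/-- The local state of a peer in the voting protocol: the number of rounds completed, the bits
found so far, and for the current bit its value (if known), whether the peer has voted on it, and
the votes received; moreover the set of blacklisted peers. -/
structure VoteState (n k : ℕ) where
  time : ℕ
  value : Fin n → Bool
  known : Option Bool
  voted : Bool
  votes : Fin k → Option Bool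
  black : Finset (Fin k)

namespace VoteState

variable {n k : ℕ} (b : ℕ) (θ : ℕ → ℕ)

/-- The number of votes for `v`. -/
def count (w : Fin k → Option Bool) (v : Bool) : ℕ :=
  (Finset.univ.filter fun q => w q = some v).card

/-- The coin of the current phase. -/
def toss (s : VoteState n k) (r : Fin b → Bool) : Bool := coin (s.time % (b + 1)) r

/-- The current bit is queried if it is unknown and the coin of the phase shows up. -/
def query (s : VoteState n k) (r : Fin b → Bool) : Finset (Fin n) :=
  if s.known = none ∧ s.toss b r = true then
    Finset.univ.filter fun i => (i : ℕ) = s.time / (b + 1)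
  else ∅

/-- What the peer knows about the current bit once its query is answered. -/
def learned (s : VoteState n k) (r : Fin b → Bool) (ans : Fin n → Option Bool) : Option Bool :=
  match s.known with
  | some v => some v
  | none => if s.toss b r = true then
      (if h : s.time / (b + 1) < n then ans ⟨s.time / (b + 1), h⟩ else none) else none

/-- A peer votes at most once on a bit, when the coin of the phase shows up. -/
def vote (s : VoteState n k) (r : Fin b → Bool) (ans : Fin n → Option Bool) : Option Msg :=
  if s.toss b r = true ∧ s.voted = false then (s.learned b r ans).map fun v => [v] else none

/-- The first vote of each peer that is not blacklisted is recorded. -/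
def newVotes (s : VoteState n k) (msgs : Fin k → Option Msg) (q : Fin k) : Option Bool :=
  if q ∈ s.black ∨ (s.votes q).isSome = true then s.votes q
  else match msgs q with
    | some [v] => some v
    -- A malformed message counts as no vote.
    | _ => none

/-- A value is rejected if it has fewer votes than the threshold of the phase. -/
def decision (s : VoteState n k) (r : Fin b → Bool) (ans : Fin n → Option Bool)
    (msgs : Fin k → Option Msg) : Option Bool :=
  match s.learned b r ans with
  | some v => some v
  | none =>
    -- If both counts are too small the answer is arbitrary; enough honest votes exclude this case.
    if count (s.newVotes msgs) true < θ (s.time % (b + 1)) then some false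
    else if count (s.newVotes msgs) false < θ (s.time % (b + 1)) then some true
    else none

/-- The state after a round. At the end of the last phase all peers are blacklisted that voted for
the wrong value. -/
def next (s : VoteState n k) (r : Fin b → Bool) (ans : Fin n → Option Bool)
    (msgs : Fin k → Option Msg) : VoteState n k :=
  if s.time % (b + 1) = b then
    { time := s.time + 1
      value := fun i => if (i : ℕ) = s.time / (b + 1) then
        -- With genuine answers the default is never used: the coin of the last phase always shows
        -- up, so the bit is known.
        (s.decision b θ r ans msgs).getD false else s.value i
      known := none
      voted := false
      votes := fun _ => none
      black := s.black ∪ Finset.univ.filter fun q =>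
        s.newVotes msgs q = some (!(s.decision b θ r ans msgs).getD false) }
  else
    { time := s.time + 1
      value := s.value
      known := s.decision b θ r ans msgs
      voted := s.voted || s.toss b r
      votes := s.newVotes msgs
      black := s.black }

theorem next_time (s : VoteState n k) (r : Fin b → Bool) (ans : Fin n → Option Bool)
    (msgs : Fin k → Option Msg) : (s.next b θ r ans msgs).time = s.time + 1 := by
  unfold next; split_ifs <;> rfl

theorem card_query_le (s : VoteState n k) (r : Fin b → Bool) :
    (s.query b r).card ≤ if s.known = none ∧ s.toss b r = true then 1 else 0 := by
  unfold query
  split_ifs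
  · refine Finset.card_le_one.2 fun i hi j hj => Fin.ext ?_
    simp only [Finset.mem_filter, Finset.mem_univ, true_and] at hi hj
    rw [hi, hj]
  · simp

theorem length_vote_le (s : VoteState n k) (r : Fin b → Bool) (ans : Fin n → Option Bool) :
    ((s.vote b r ans).getD []).length ≤ 1 := by
  unfold vote
  split_ifs
  · cases s.learned b r ans <;> simp
  · simp

/-- The answer to the peer's own query tells it the current bit. -/
theorem learned_answers (X : Fin n → Bool) (s : VoteState n k) (r : Fin b → Bool) (i : Fin n)
    (hi : (i : ℕ) = s.time / (b + 1)) :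
    s.learned b r (answers X (s.query b r)) =
      match s.known with
      | some v => some v
      | none => if s.toss b r = true then some (X i) else none := by
  unfold learned
  cases hk : s.known with
  | some v => rfl
  | none =>
    dsimp only
    by_cases hc : s.toss b r = true
    · have hlt : s.time / (b + 1) < n := hi ▸ i.2
      have hii : (⟨s.time / (b + 1), hlt⟩ : Fin n) = i := Fin.ext hi.symm
      simp [hc, hlt, hii, answers, query, hk, hi]
    · simp [hc]

theorem newVotes_eq_some_of_eq_some {s : VoteState n k} {q : Fin k} {v : Bool}
    (h : s.votes q = some v) (msgs : Fin k → Option Msg) : s.newVotes msgs q = some v := by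
  simp [newVotes, h]

theorem count_le_count_newVotes (s : VoteState n k) (msgs : Fin k → Option Msg) (v : Bool) :
    count s.votes v ≤ count (s.newVotes msgs) v := by
  refine Finset.card_le_card fun q hq => ?_
  simp only [Finset.mem_filter, Finset.mem_univ, true_and] at hq ⊢
  exact newVotes_eq_some_of_eq_some hq msgs

end VoteState

/-- The voting protocol with `b + 1` phases per input bit and threshold `θ j` in phase `j`. -/
def votingProtocol (n k b : ℕ) (θ : ℕ → ℕ) : Protocol n k where
  State := VoteState n k
  bits := b
  init _ := ⟨0, fun _ => false, none, false, fun _ => none, ∅⟩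
  query _ s r := s.query b r
  send _ s r ans _ := s.vote b r ans
  next _ s r ans msgs := s.next b θ r ans msgs
  output s := if n * (b + 1) ≤ s.time then some s.value else none

theorem div_mod_succ_of_eq {b t : ℕ} (h : t % (b + 1) = b) :
    (t + 1) / (b + 1) = t / (b + 1) + 1 ∧ (t + 1) % (b + 1) = 0 := by
  have h1 := Nat.div_add_mod t (b + 1)
  have h2 : t + 1 = (b + 1) * (t / (b + 1) + 1) := by rw [mul_add]; omega
  constructor
  · conv_lhs => rw [h2]
    exact Nat.mul_div_cancel_left _ (Nat.succ_pos b)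
  · rw [h2]; exact Nat.mul_mod_right _ _

theorem div_mod_succ_of_ne {b t : ℕ} (h : t % (b + 1) ≠ b) :
    (t + 1) / (b + 1) = t / (b + 1) ∧ (t + 1) % (b + 1) = t % (b + 1) + 1 := by
  have h1 := Nat.div_add_mod t (b + 1)
  have h3 : t % (b + 1) < b + 1 := Nat.mod_lt t (Nat.succ_pos b)
  have h2 : t + 1 = (t % (b + 1) + 1) + (b + 1) * (t / (b + 1)) := by omega
  constructor
  · conv_lhs => rw [h2]
    rw [Nat.add_mul_div_left _ _ (Nat.succ_pos b), Nat.div_eq_of_lt (by omega)]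
    omega
  · conv_lhs => rw [h2]
    rw [Nat.add_mul_mod_self_left, Nat.mod_eq_of_lt (by omega)]

/-! ### The query potential -/

/-- The probability that a peer in state `s` queries a bit in this round. -/
def VoteState.queryRate {n k : ℕ} (b : ℕ) (s : VoteState n k) : ℝ :=
  if s.known = none then 2 ^ (s.time % (b + 1)) / 2 ^ b else 0

/-- The potential invariant: the sum `a` of the query rates so far is paid for by a base rate per
input bit and by the peers that are, or are about to be, blacklisted. -/
structure VoteState.Paid {n k : ℕ} (b : ℕ) (θ : ℕ → ℕ) (K : ℝ) (s : VoteState n k) (a : ℝ) :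
    Prop where
  fresh : s.time % (b + 1) = 0 → s.known = none
  unknown : s.known = none →
    a + 1 / 2 ^ b ≤ (s.time / (b + 1) : ℕ) * (1 / 2 ^ b) + K * s.black.card +
      2 ^ (s.time % (b + 1)) / 2 ^ b
  split : s.known = none → ∀ j, s.time % (b + 1) = j + 1 → ∀ v, θ j ≤ VoteState.count s.votes v
  known : s.known ≠ none → ∀ v,
    a ≤ ((s.time / (b + 1) : ℕ) + 1) * (1 / 2 ^ b) +
      K * (s.black.card + VoteState.count s.votes v)
  disjoint : ∀ q, s.votes q ≠ none → q ∉ s.black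

/-- While a bit is open its rates add up to 1 + 2 + ... + 2^(j-1) = 2^j - 1 in units of 1/2^b; the
missing unit is the 1/2^b on the left of `unknown`. Once it is known, the votes for either value can
pay, so it does not matter which value is correct. -/
theorem VoteState.Paid.next {n k b : ℕ} {θ : ℕ → ℕ} {K : ℝ} (hK : 0 ≤ K)
    (hθ : ∀ j < b, 2 * (2 ^ (j + 1) / 2 ^ b) ≤ K * θ j) {s : VoteState n k} {a : ℝ}
    (h : s.Paid b θ K a) (r : Fin b → Bool) (ans : Fin n → Option Bool)
    (msgs : Fin k → Option Msg) :
    (s.next b θ r ans msgs).Paid b θ K (a + s.queryRate b) := by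
  have hdis : ∀ q, s.newVotes msgs q ≠ none → q ∉ s.black := by
    intro q hq hb
    rw [newVotes, if_pos (Or.inl hb)] at hq
    exact h.disjoint q hq hb
  have hjb : s.time % (b + 1) ≤ b := Nat.lt_succ_iff.1 (Nat.mod_lt _ (Nat.succ_pos b))
  have hcnt : ∀ v, (count s.votes v : ℝ) ≤ count (s.newVotes msgs) v := fun v => by
    exact_mod_cast s.count_le_count_newVotes msgs v
  -- the cost of the current round is covered whatever the outcome
  have hpay : ∀ v, a + s.queryRate b ≤ ((s.time / (b + 1) : ℕ) + 1) * (1 / 2 ^ b) +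
      K * (s.black.card + count (s.newVotes msgs) v) := by
    intro v
    have hv := mul_le_mul_of_nonneg_left (hcnt v) hK
    by_cases hk : s.known = none
    · have h1 := h.unknown hk
      rw [queryRate, if_pos hk]
      -- In phase 0 the base rate pays. In a later phase both values passed the preceding threshold,
      -- and by `hθ` its votes are worth twice the current rate, which exceeds the geometric sum.
      rcases Nat.eq_zero_or_eq_succ_pred (s.time % (b + 1)) with h0 | h0
      · rw [h0] at h1 ⊢
        have : 0 ≤ K * count (s.newVotes msgs) v := by positivity
        simp only [pow_zero] at h1 ⊢
        linarith
      · set j := (s.time % (b + 1)).pred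
        have h2 := h.split hk j h0 v
        have h3 := hθ j (by omega)
        have h4 : K * θ j ≤ K * count s.votes v :=
          mul_le_mul_of_nonneg_left (by exact_mod_cast h2) hK
        rw [h0] at h1 ⊢
        have h5 : (0 : ℝ) ≤ 1 / 2 ^ b := by positivity
        simp only [Nat.succ_eq_add_one] at *
        linarith
    · have h1 := h.known hk v
      rw [queryRate, if_neg hk]
      linarith
  by_cases hj : s.time % (b + 1) = b
  · obtain ⟨hd, hm⟩ := div_mod_succ_of_eq hj
    rw [VoteState.next, if_pos hj]
    refine ⟨fun _ => rfl, fun _ => ?_, fun _ j hj' => ?_, fun hk => absurd rfl hk,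
      fun q hq => absurd rfl hq⟩
    · dsimp only
      rw [hd, hm, Finset.card_union_of_disjoint]
      -- The losing voters turn into blacklisted peers; they are new on the list, so the
      -- cardinalities add up.
      · have := hpay (!(s.decision b θ r ans msgs).getD false)
        rw [count] at this
        push_cast
        simp only [pow_zero]
        linarith
      · rw [Finset.disjoint_right]
        intro q hq
        exact hdis q (by rw [(Finset.mem_filter.1 hq).2]; simp)
    · dsimp only at hj'
      omega
  · obtain ⟨hd, hm⟩ := div_mod_succ_of_ne hj
    rw [VoteState.next, if_neg hj]
    refine ⟨fun h0 => ?_, fun hk => ?_, fun hk j hj' v => ?_, fun hk v => ?_, hdis⟩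
    · dsimp only at h0
      omega
    · dsimp only at hk ⊢
      rw [hd, hm]
      have hkn : s.known = none := by
        by_contra hne
        obtain ⟨v, hv⟩ := Option.ne_none_iff_exists'.1 hne
        simp [decision, learned, hv] at hk
      have h1 := h.unknown hkn
      rw [queryRate, if_pos hkn, pow_succ]
      have h2 : (2 : ℝ) ^ (s.time % (b + 1)) * 2 / 2 ^ b =
        2 ^ (s.time % (b + 1)) / 2 ^ b + 2 ^ (s.time % (b + 1)) / 2 ^ b := by ring
      linarith
    · dsimp only at hk hj' ⊢
      have hjj : s.time % (b + 1) = j := by omega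
      rw [decision, hjj] at hk
      split at hk
      · simp at hk
      · split_ifs at hk with h1 h2
        cases v
        · exact not_lt.1 h2
        · exact not_lt.1 h1
    · dsimp only
      rw [hd]
      exact hpay v

/-! ### Executions: corruption, locality, clocks and message counts -/

namespace Adversary

variable {k b : ℕ} {β : ℝ} (A : Adversary k b β) (ω : Tape k b)

theorem corrupt_mono {s t : ℕ} (h : s ≤ t) :
    A.corrupt s (history ω s) ⊆ A.corrupt t (history ω t) := by
  induction t, h using Nat.le_induction with
  | base => exact subset_rfl
  | succ t _ ih => exact ih.trans (A.fixed t (history ω (t + 1)))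

theorem faulty_succ (t : ℕ) : A.faulty ω (t + 1) = A.corrupt t (history ω t) := by
  refine Finset.Subset.antisymm (Finset.biUnion_subset.2 fun s hs => ?_) ?_
  · exact A.corrupt_mono ω (Nat.lt_succ_iff.1 (Finset.mem_range.1 hs))
  · exact Finset.subset_biUnion_of_mem (fun s => A.corrupt s (history ω s))
      (Finset.self_mem_range_succ t)

theorem faulty_subset_succ (t : ℕ) : A.faulty ω t ⊆ A.faulty ω (t + 1) :=
  Finset.biUnion_subset_biUnion_of_subset_left _ (Finset.range_mono (Nat.le_succ t))

/-- Rules out that the execution ends early because termination is vacuous. -/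
theorem exists_notMem_faulty (hβ : β < 1) (hk : 0 < k) (t : ℕ) : ∃ p, p ∉ A.faulty ω t := by
  cases t with
  | zero => exact ⟨⟨0, hk⟩, by simp [faulty]⟩
  | succ t =>
    by_contra! h
    have h1 := A.budget t (history ω t)
    rw [← A.faulty_succ ω t, Finset.eq_univ_of_forall h] at h1
    have : (0 : ℝ) < k := by exact_mod_cast hk
    simp only [Finset.card_univ, Fintype.card_fin] at h1
    nlinarith

end Adversary

/-- The configuration after `t` rounds depends only on the random bits of these rounds. -/
theorem Protocol.run_congr {n k : ℕ} (P : Protocol n k) (X : Fin n → Bool) {β : ℝ}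
    (A : Adversary k P.bits β) {ω ω' : Tape k P.bits} {t : ℕ} (h : ∀ s < t, ω s = ω' s) :
    P.run X A ω t = P.run X A ω' t := by
  induction t with
  | zero => rfl
  | succ t ih =>
    have hh : history ω t = history ω' t := funext fun s => h s (s.2.trans (Nat.lt_succ_self t))
    simp only [Protocol.run, hh, h t (Nat.lt_succ_self t),
      ih fun s hs => h s (hs.trans t.lt_succ_self)]

theorem Protocol.step_state_of_active {n k : ℕ} (P : Protocol n k) (X : Fin n → Bool)
    (B : Finset (Fin k)) (forged : Fin k → Fin k → Option Msg) (r : RoundBits k P.bits)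
    (c : Config n k P.State) {p : Fin k} (hp : p ∉ B) (hout : P.output (c.state p) = none) :
    (P.step X B forged r c).state p = P.next p (c.state p) (r p)
      (answers X (P.query p (c.state p) (r p))) (fun q => P.sent X B forged r c.state q p) := by
  simp [Protocol.step, Protocol.queriesOf, hp, hout]

section Execution

variable {n k b : ℕ} {β : ℝ}

/-- The state of peer `p` after `t` rounds of the voting protocol. -/
def voteStateAt (θ : ℕ → ℕ) (X : Fin n → Bool) (A : Adversary k b β) (ω : Tape k b) (t : ℕ)
    (p : Fin k) : VoteState n k :=
  ((votingProtocol n k b θ).run X A ω t).state p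

/-- The message from `q` to `p` in round `t` of the voting protocol. -/
def voteSentAt (θ : ℕ → ℕ) (X : Fin n → Bool) (A : Adversary k b β) (ω : Tape k b) (t : ℕ)
    (q p : Fin k) : Option Msg :=
  (votingProtocol n k b θ).sent X (A.corrupt t (history ω t)) (A.forge t (history ω t)) (ω t)
    ((votingProtocol n k b θ).run X A ω t).state q p

variable {θ : ℕ → ℕ} {X : Fin n → Bool} {A : Adversary k b β} {ω : Tape k b} {t : ℕ}

theorem voteStateAt_succ {p : Fin k} (hp : p ∉ A.corrupt t (history ω t))
    (ht : (voteStateAt θ X A ω t p).time < n * (b + 1)) :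
    voteStateAt θ X A ω (t + 1) p = (voteStateAt θ X A ω t p).next b θ (ω t p)
      (answers X ((voteStateAt θ X A ω t p).query b (ω t p)))
      (fun q => voteSentAt θ X A ω t q p) := by
  exact Protocol.step_state_of_active _ _ _ _ _ _ hp (if_neg (not_le.2 ht))

theorem voteSentAt_eq {q p : Fin k} (hqp : q ≠ p) (hq : q ∉ A.corrupt t (history ω t))
    (ht : (voteStateAt θ X A ω t q).time < n * (b + 1)) :
    voteSentAt θ X A ω t q p = (voteStateAt θ X A ω t q).vote b (ω t q)
      (answers X ((voteStateAt θ X A ω t q).query b (ω t q))) := by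
  have hout : (votingProtocol n k b θ).output
      (((votingProtocol n k b θ).run X A ω t).state q) = none := if_neg (not_le.2 ht)
  unfold voteSentAt Protocol.sent Protocol.sendOf Protocol.queriesOf
  rw [hout, if_neg hqp, if_neg hq, if_neg (by simp), if_neg (by simp)]
  rfl

theorem length_voteSentAt_le {q p : Fin k} (hq : q ∉ A.corrupt t (history ω t)) :
    ((voteSentAt θ X A ω t q p).getD []).length ≤ 1 := by
  unfold voteSentAt Protocol.sent Protocol.sendOf
  rw [if_neg hq]
  split_ifs
  · simp
  · simp
  · exact VoteState.length_vote_le _ _ _ _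

theorem messageSizeAtMost_votingProtocol (θ : ℕ → ℕ) (X : Fin n → Bool) (A : Adversary k b β) :
    (votingProtocol n k b θ).MessageSizeAtMost X A 1 := by
  intro ω t
  induction t with
  | zero => intro p _; exact Nat.zero_le _
  | succ t ih =>
    intro p hp
    have hpc : p ∉ A.corrupt t (history ω t) := (A.faulty_succ ω t) ▸ hp
    exact max_le (ih p fun h => hp (A.faulty_subset_succ ω t h))
      (Finset.sup_le fun q _ => length_voteSentAt_le hpc)

theorem voteStateAt_time (ht : t ≤ n * (b + 1)) {p : Fin k} (hp : p ∉ A.faulty ω t) :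
    (voteStateAt θ X A ω t p).time = t := by
  induction t with
  | zero => rfl
  | succ t ih =>
    have h1 := ih (by omega) fun h => hp (A.faulty_subset_succ ω t h)
    rw [voteStateAt_succ (by rwa [← A.faulty_succ]) (by omega), VoteState.next_time, h1]

/-- A nonfaulty peer votes at most once on each input bit. -/
theorem messages_le (ht : t ≤ n * (b + 1)) {p : Fin k} (hp : p ∉ A.faulty ω t) :
    ((votingProtocol n k b θ).run X A ω t).messages p ≤
        k * (t / (b + 1) + (voteStateAt θ X A ω t p).voted.toNat) ∧
      (t % (b + 1) = 0 → (voteStateAt θ X A ω t p).voted = false) := by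
  induction t with
  | zero => exact ⟨Nat.zero_le _, fun _ => rfl⟩
  | succ t ih =>
    have hp' : p ∉ A.faulty ω t := fun h => hp (A.faulty_subset_succ ω t h)
    have htime := voteStateAt_time (θ := θ) (X := X) (by omega : t ≤ n * (b + 1)) hp'
    obtain ⟨h1, -⟩ := ih (by omega) hp'
    rw [Adversary.faulty_succ] at hp
    set s := voteStateAt θ X A ω t p with hs
    rw [voteStateAt_succ hp (by rw [← hs]; omega), ← hs]
    have hmsg : ((votingProtocol n k b θ).run X A ω (t + 1)).messages p ≤
        ((votingProtocol n k b θ).run X A ω t).messages p +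
          if s.toss b (ω t p) = true ∧ s.voted = false then k else 0 := by
      change _ + (Finset.univ.filter fun q => (voteSentAt θ X A ω t p q).isSome = true).card ≤ _
      gcongr
      split_ifs with hc
      · exact (Finset.card_le_univ _).trans (by simp)
      · rw [Nat.le_zero, Finset.card_eq_zero, Finset.filter_eq_empty_iff]
        intro q _
        by_cases hpq : p = q
        · simp [voteSentAt, Protocol.sent, hpq]
        · rw [voteSentAt_eq hpq hp (by rw [← hs]; omega), ← hs, VoteState.vote, if_neg hc]
          simp
    have hbound : ((votingProtocol n k b θ).run X A ω (t + 1)).messages p ≤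
        k * (t / (b + 1) + (s.voted || s.toss b (ω t p)).toNat) := by
      refine hmsg.trans ?_
      cases hv : s.voted <;> cases hc : s.toss b (ω t p) <;> simp [hv] at h1 ⊢ <;> linarith
    by_cases hj : t % (b + 1) = b
    · obtain ⟨hd, hm⟩ := div_mod_succ_of_eq hj
      rw [hd, VoteState.next, if_pos (by rw [htime]; exact hj)]
      refine ⟨hbound.trans (Nat.mul_le_mul_left _ ?_), fun _ => rfl⟩
      have := Bool.toNat_le (s.voted || s.toss b (ω t p))
      omega
    · obtain ⟨hd, hm⟩ := div_mod_succ_of_ne hj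
      rw [hd, VoteState.next, if_neg (by rw [htime]; exact hj)]
      exact ⟨hbound, fun h => by omega⟩

/-- The query rates of a nonfaulty peer always satisfy the potential invariant. -/
theorem paid_voteStateAt {K : ℝ} (hK : 0 ≤ K)
    (hθ : ∀ j < b, 2 * (2 ^ (j + 1) / 2 ^ b) ≤ K * θ j) (ht : t ≤ n * (b + 1)) {p : Fin k}
    (hp : p ∉ A.faulty ω t) :
    (voteStateAt θ X A ω t p).Paid b θ K
      (∑ s ∈ Finset.range t, (voteStateAt θ X A ω s p).queryRate b) := by
  induction t with
  | zero =>
    refine ⟨fun _ => rfl, fun _ => ?_, fun _ j hj => ?_, fun h => absurd rfl h,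
      fun q hq => absurd rfl hq⟩
    · simp [voteStateAt, Protocol.run, votingProtocol]
    · simp [voteStateAt, Protocol.run, votingProtocol] at hj
  | succ t ih =>
    have hp' : p ∉ A.faulty ω t := fun h => hp (A.faulty_subset_succ ω t h)
    have htime := voteStateAt_time (θ := θ) (X := X) (by omega : t ≤ n * (b + 1)) hp'
    rw [Adversary.faulty_succ] at hp
    rw [Finset.sum_range_succ, voteStateAt_succ hp (by omega)]
    exact (ih (by omega) hp').next hK hθ _ _ _

/-- At the end no votes are pending, and the blacklist has at most k members. -/
theorem sum_queryRate_le {K : ℝ} (hK : 0 ≤ K)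
    (hθ : ∀ j < b, 2 * (2 ^ (j + 1) / 2 ^ b) ≤ K * θ j) {p : Fin k}
    (hp : p ∉ A.faulty ω (n * (b + 1))) :
    ∑ s ∈ Finset.range (n * (b + 1)), (voteStateAt θ X A ω s p).queryRate b ≤
      n / 2 ^ b + K * k := by
  have h := paid_voteStateAt (X := X) hK hθ le_rfl hp
  have htime := voteStateAt_time (θ := θ) (X := X) le_rfl hp
  have h1 := h.unknown (h.fresh (by rw [htime]; exact Nat.mul_mod_left _ _))
  rw [htime, Nat.mul_mod_left, Nat.mul_div_cancel _ (Nat.succ_pos b), pow_zero] at h1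
  have h2 : K * ((voteStateAt θ X A ω (n * (b + 1)) p).black.card : ℝ) ≤ K * k := by
    refine mul_le_mul_of_nonneg_left ?_ hK
    exact_mod_cast (Finset.card_le_univ _).trans (by simp)
  have h3 : (n : ℝ) * (1 / 2 ^ b) = n / 2 ^ b := by ring
  linarith

/-! ### Correctness -/

/-- In round `t` enough uncorrupted peers toss the coin of the phase successfully. -/
def EnoughVotes (θ : ℕ → ℕ) (A : Adversary k b β) (ω : Tape k b) (t : ℕ) : Prop :=
  θ (t % (b + 1)) ≤ (Finset.univ.filter fun q => q ∉ A.corrupt t (history ω t) ∧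
    coin (t % (b + 1)) (ω t q) = true).card

/-- The invariant of a nonfaulty peer `p`: whatever it has found out is true, and nonfaulty peers
are not blacklisted and have their votes recorded. -/
structure Sound (θ : ℕ → ℕ) (X : Fin n → Bool) (A : Adversary k b β) (ω : Tape k b) (t : ℕ)
    (p : Fin k) : Prop where
  value : ∀ i : Fin n, (i : ℕ) < t / (b + 1) → (voteStateAt θ X A ω t p).value i = X i
  known : ∀ i : Fin n, (i : ℕ) = t / (b + 1) → ∀ v,
    (voteStateAt θ X A ω t p).known = some v → v = X i
  black : ∀ q ∉ A.faulty ω t, q ∉ (voteStateAt θ X A ω t p).black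
  self : (voteStateAt θ X A ω t p).votes p = none
  votes : ∀ i : Fin n, (i : ℕ) = t / (b + 1) → ∀ q ∉ A.faulty ω t, q ≠ p →
    (voteStateAt θ X A ω t p).votes q =
      if (voteStateAt θ X A ω t q).voted = true then some (X i) else none

/-- An uncorrupted peer whose coin shows up votes now or has voted on this bit before, in both cases
for the true value. All these votes are on record, so the true value is never rejected and no honest
voter is blacklisted. -/
theorem sound_succ (ht : t < n * (b + 1)) (hvotes : EnoughVotes θ A ω t)
    (ih : ∀ p ∉ A.faulty ω t, Sound θ X A ω t p) {p : Fin k} (hp : p ∉ A.faulty ω (t + 1)) :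
    Sound θ X A ω (t + 1) p := by
  have hsub : ∀ q ∉ A.corrupt t (history ω t), q ∉ A.faulty ω t := fun q hq h =>
    hq (A.faulty_succ ω t ▸ A.faulty_subset_succ ω t h)
  have htime : ∀ q ∉ A.corrupt t (history ω t), (voteStateAt θ X A ω t q).time = t :=
    fun q hq => voteStateAt_time ht.le (hsub q hq)
  have hi : t / (b + 1) < n := Nat.div_lt_of_lt_mul (by rwa [mul_comm])
  set i : Fin n := ⟨t / (b + 1), hi⟩ with hidef
  have hlearned : ∀ q ∉ A.corrupt t (history ω t), ∀ v,
      (voteStateAt θ X A ω t q).learned b (ω t q)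
        (answers X ((voteStateAt θ X A ω t q).query b (ω t q))) = some v → v = X i := by
    intro q hq v hv
    rw [VoteState.learned_answers b X _ _ i (by rw [htime q hq])] at hv
    split at hv
    · rename_i u hu
      exact Option.some.inj hv ▸ (ih q (hsub q hq)).known i rfl u hu
    · split_ifs at hv
      exact (Option.some.inj hv).symm
  have htossed : ∀ q ∉ A.corrupt t (history ω t),
      (voteStateAt θ X A ω t q).toss b (ω t q) = true →
      (voteStateAt θ X A ω t q).learned b (ω t q)
        (answers X ((voteStateAt θ X A ω t q).query b (ω t q))) = some (X i) := by
    intro q hq hc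
    have hne : (voteStateAt θ X A ω t q).learned b (ω t q)
        (answers X ((voteStateAt θ X A ω t q).query b (ω t q))) ≠ none := by
      rw [VoteState.learned_answers b X _ _ i (by rw [htime q hq])]
      split <;> simp [hc]
    obtain ⟨v, hv⟩ := Option.ne_none_iff_exists'.1 hne
    rw [hv, hlearned q hq v hv]
  have hpc : p ∉ A.corrupt t (history ω t) := by rwa [← A.faulty_succ]
  have hS := ih p (hsub p hpc)
  have hlearnedp := hlearned p hpc
  have htossedp := htossed p hpc
  have htp := htime p hpc
  have hSvotes := hS.votes i rfl
  have hSblack := hS.black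
  have hSself := hS.self
  set s := voteStateAt θ X A ω t p with hs
  set msgs : Fin k → Option Msg := fun q => voteSentAt θ X A ω t q p with hmsgs
  set ans := answers X (s.query b (ω t p)) with hans
  -- the votes of uncorrupted peers are recorded
  have hnew : ∀ q ∉ A.corrupt t (history ω t), q ≠ p → s.newVotes msgs q =
      if ((voteStateAt θ X A ω t q).voted || (voteStateAt θ X A ω t q).toss b (ω t q)) = true
        then some (X i) else none := by
    intro q hq hqp
    have h1 := hSvotes q (hsub q hq) hqp
    have h2 := hSblack q (hsub q hq)
    cases hv : (voteStateAt θ X A ω t q).voted with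
    | true =>
      rw [hv, if_pos rfl] at h1
      simpa using VoteState.newVotes_eq_some_of_eq_some h1 msgs
    | false =>
      rw [hv, if_neg (by simp)] at h1
      rw [VoteState.newVotes, if_neg (by simp [h1, h2])]
      simp only [hmsgs]
      rw [voteSentAt_eq hqp hq (by rw [htime q hq]; exact ht), VoteState.vote]
      cases hc : (voteStateAt θ X A ω t q).toss b (ω t q) with
      | true => simp [hv, htossed q hq hc]
      | false => simp
  have hself : s.newVotes msgs p = none := by
    have hm : msgs p = none := by simp [hmsgs, voteSentAt, Protocol.sent]
    simp [VoteState.newVotes, hSself, hm]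
  -- hence the decision is right
  have hdec : ∀ v, s.decision b θ (ω t p) ans msgs = some v → v = X i := by
    intro v hv
    unfold VoteState.decision at hv
    split at hv
    · rename_i u hu
      exact Option.some.inj hv ▸ hlearnedp u hu
    · rename_i hnone
      have hcoin : s.toss b (ω t p) ≠ true := fun hc => by
        rw [hans, htossedp hc] at hnone
        simp at hnone
      have hcount : θ (s.time % (b + 1)) ≤ VoteState.count (s.newVotes msgs) (X i) := by
        rw [htp]
        refine hvotes.trans (Finset.card_le_card fun q hq => ?_)
        simp only [Finset.mem_filter, Finset.mem_univ, true_and] at hq ⊢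
        have hc : (voteStateAt θ X A ω t q).toss b (ω t q) = true := by
          rw [VoteState.toss, htime q hq.1]; exact hq.2
        -- A peer records no vote of its own, but an undecided `p` had no successful coin and is not
        -- among the peers counted.
        have hqp : q ≠ p := fun h => hcoin (by rw [hs, ← h]; exact hc)
        rw [hnew q hq.1 hqp, hc]
        simp
      split_ifs at hv with h1 h2
      · cases hX : X i
        · exact (Option.some.inj hv).symm
        · rw [hX] at hcount; omega
      · cases hX : X i
        · rw [hX] at hcount; omega
        · exact (Option.some.inj hv).symm
  have hstep := voteStateAt_succ (θ := θ) (X := X) hpc (by rw [← hs, htp]; exact ht)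
  rw [← hs, ← hans, ← hmsgs] at hstep
  by_cases hj : t % (b + 1) = b
  · obtain ⟨hd, hm⟩ := div_mod_succ_of_eq hj
    have hgetD : (s.decision b θ (ω t p) ans msgs).getD false = X i := by
      have hc : s.toss b (ω t p) = true := by
        rw [VoteState.toss, htp, hj]
        exact coin_self _
      simp [VoteState.decision, htossedp hc]
    rw [VoteState.next, if_pos (by rw [htp]; exact hj)] at hstep
    refine ⟨fun l hl => ?_, fun l hl v hv => ?_, fun q hq => ?_, ?_,
      fun l hl q hq hqp => ?_⟩
    · rw [hstep]
      simp only [htp, hgetD]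
      split_ifs with hli
      · rw [show l = i from Fin.ext hli]
      · exact hS.value l (by omega)
    · rw [hstep] at hv
      simp at hv
    · rw [A.faulty_succ] at hq
      rw [hstep]
      simp only [Finset.mem_union, not_or, Finset.mem_filter, Finset.mem_univ, true_and, hgetD]
      refine ⟨hSblack q (hsub q hq), fun hbad => ?_⟩
      by_cases hqp : q = p
      · rw [hqp, hself] at hbad
        simp at hbad
      · rw [hnew q hq hqp] at hbad
        split_ifs at hbad
        simp at hbad
    · rw [hstep]
    · rw [A.faulty_succ] at hq
      have hq' := voteStateAt_succ (θ := θ) (X := X) hq (by rw [htime q hq]; exact ht)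
      rw [VoteState.next, if_pos (by rw [htime q hq]; exact hj)] at hq'
      rw [hstep, hq']
      simp
  · obtain ⟨hd, hm⟩ := div_mod_succ_of_ne hj
    rw [VoteState.next, if_neg (by rw [htp]; exact hj)] at hstep
    refine ⟨fun l hl => ?_, fun l hl v hv => ?_, fun q hq => ?_, ?_,
      fun l hl q hq hqp => ?_⟩
    · rw [hstep]
      exact hS.value l (by omega)
    · rw [hstep] at hv
      rw [show l = i from Fin.ext (by rw [hl, hd])]
      exact hdec v hv
    · rw [A.faulty_succ] at hq
      rw [hstep]
      exact hSblack q (hsub q hq)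
    · rw [hstep]
      exact hself
    · rw [A.faulty_succ] at hq
      have hq' := voteStateAt_succ (θ := θ) (X := X) hq (by rw [htime q hq]; exact ht)
      rw [VoteState.next, if_neg (by rw [htime q hq]; exact hj)] at hq'
      rw [hstep, hq', show l = i from Fin.ext (by rw [hl, hd])]
      exact hnew q hq hqp

theorem sound_of_enoughVotes (ht : t ≤ n * (b + 1)) (hvotes : ∀ s < t, EnoughVotes θ A ω s) :
    ∀ p ∉ A.faulty ω t, Sound θ X A ω t p := by
  induction t with
  | zero =>
    intro p _
    refine ⟨fun i hi => ?_, fun i _ v hv => ?_, fun q _ => ?_, rfl,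
      fun i _ q _ _ => ?_⟩
    · simp at hi
    · simp [voteStateAt, Protocol.run, votingProtocol] at hv
    · simp [voteStateAt, Protocol.run, votingProtocol]
    · simp [voteStateAt, Protocol.run, votingProtocol]
  | succ t ih =>
    intro p hp
    exact sound_succ (by omega) (hvotes t t.lt_succ_self)
      (ih (by omega) fun s hs => hvotes s (hs.trans t.lt_succ_self)) hp

end Execution

/-! ### Tail bounds and the union bound -/

variable {n k b : ℕ} {β : ℝ}

/-- In a phase with coin probability `2 ^ j / 2 ^ b`, too few uncorrupted peers toss the coin
successfully only with exponentially small probability. -/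
theorem tapeMeasure_not_enoughVotes_le (A : Adversary k b β) {θ : ℕ → ℕ}
    (hβ : β < 1)
    (hθ : ∀ j, θ j = ⌈(1 - β) * k * (2 ^ j / 2 ^ b) / 2⌉₊) {D : ℝ}
    (hD : 0 < b → D ≤ (1 - β) * k / 2 ^ b) (t : ℕ) :
    tapeMeasure k b {ω | ¬ EnoughVotes θ A ω t} ≤ ENNReal.ofReal (Real.exp (-(3 / 20 * D))) := by
  set j := t % (b + 1) with hj
  have hjb : j ≤ b := Nat.lt_succ_iff.1 (Nat.mod_lt _ (Nat.succ_pos b))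
  set q : ℝ := 2 ^ j / 2 ^ b with hq
  set g : ℝ := (1 - β) * k with hg
  have hq0 : 0 < q := by positivity
  have hg0 : 0 ≤ g := mul_nonneg (by linarith) (Nat.cast_nonneg k)
  have hgood : ∀ h : Fin t → RoundBits k b,
      g ≤ (Finset.univ.filter fun p => p ∉ A.corrupt t h).card := by
    intro h
    have h1 := A.budget t h
    have h2 := Finset.card_filter_add_card_filter_not (s := (Finset.univ : Finset (Fin k)))
      (fun p => p ∈ A.corrupt t h)
    rw [Finset.filter_univ_mem, Finset.card_univ, Fintype.card_fin] at h2
    have h3 : ((A.corrupt t h).card : ℝ) +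
      (Finset.univ.filter fun p => p ∉ A.corrupt t h).card = k := by exact_mod_cast h2
    rw [hg]
    linarith
  rcases hjb.lt_or_eq with hlt | heq
  -- Chernoff with base 1/2, conditional on the past: only round `t` has a nontrivial factor,
  -- exp(gq/2) · 2^(-Z), where Z counts the successful uncorrupted peers. Its mean is at most one
  -- because each such peer contributes 1 - q/2 ≤ exp(-q/2).
  · let f : (s : ℕ) → (Fin s → RoundBits k b) → RoundBits k b → ℝ := fun s h r =>
      if s = t then Real.exp (g * q / 2) *
        ∏ p, (if p ∉ A.corrupt s h then (if coin j (r p) = true then 1 + (-1 / 2 : ℝ) else 1) else 1)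
      else 1
    have hf0 : ∀ s h r, 0 ≤ f s h r := by
      intro s h r
      simp only [f]
      split_ifs
      · refine mul_nonneg (Real.exp_pos _).le (Finset.prod_nonneg fun p _ => ?_)
        split_ifs <;> norm_num
      · norm_num
    have hf : ∀ s h, ∑ r, f s h r ≤ Fintype.card (RoundBits k b) := by
      intro s h
      simp only [f]
      by_cases hs : s = t
      · subst hs
        simp only [if_true]
        rw [← Finset.mul_sum]
        have h1 := sum_roundBits_prod_le
          (fun p x => if p ∉ A.corrupt s h then
            (if coin j x = true then 1 + (-1 / 2 : ℝ) else 1) else 1)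
          (fun p => if p ∉ A.corrupt s h then Real.exp (-q / 2) else 1)
          (fun p x => by split_ifs <;> norm_num) (fun p => by
            by_cases hp : p ∉ A.corrupt s h
            · simp only [if_pos hp]
              rw [sum_coin hjb]
              gcongr
              have := Real.add_one_le_exp (-q / 2)
              linarith
            · simp only [if_neg hp]
              simp)
        rw [Finset.prod_ite, Finset.prod_const, Finset.prod_const_one, mul_one,
          ← Real.exp_nat_mul] at h1
        calc _ ≤ Real.exp (g * q / 2) * (Fintype.card (RoundBits k b) * Real.exp
              ((Finset.univ.filter fun p => p ∉ A.corrupt s h).card * (-q / 2))) :=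
              mul_le_mul_of_nonneg_left h1 (Real.exp_pos _).le
          _ = Fintype.card (RoundBits k b) * Real.exp (g * q / 2 +
              (Finset.univ.filter fun p => p ∉ A.corrupt s h).card * (-q / 2)) := by
              rw [Real.exp_add]; ring
          _ ≤ Fintype.card (RoundBits k b) * 1 := by
              gcongr
              rw [Real.exp_le_one_iff]
              nlinarith [hgood h]
          _ = _ := mul_one _
      · simp [hs]
    refine (MeasureTheory.measure_mono fun ω hω => ?_).trans
      ((tapeMeasure_le_prod_le f hf0 hf (t + 1)
        (Real.exp_pos ((1 - Real.log 2) * (g * q / 2)))).trans (ENNReal.ofReal_le_ofReal ?_))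
    · rw [Set.mem_ofPred_eq, EnoughVotes, not_le, ← hj, hθ, Nat.lt_ceil] at hω
      rw [Set.mem_ofPred_eq, Finset.prod_range_succ, Finset.prod_eq_one, one_mul]
      · have hprod : ∀ p, (if p ∉ A.corrupt t (history ω t) then
            (if coin j (ω t p) = true then 1 + (-1 / 2 : ℝ) else 1) else 1) =
            if p ∉ A.corrupt t (history ω t) ∧ coin j (ω t p) = true then 2⁻¹ else 1 := by
          intro p
          by_cases h1 : p ∈ A.corrupt t (history ω t) <;>
            by_cases h2 : coin j (ω t p) = true <;> simp [h1, h2]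
          norm_num
        simp only [f, if_true]
        rw [Finset.prod_congr rfl fun p _ => hprod p, Finset.prod_ite, Finset.prod_const,
          Finset.prod_const_one, mul_one]
        set Z := (Finset.univ.filter fun p => p ∉ A.corrupt t (history ω t) ∧
          coin j (ω t p) = true).card
        have h2 : ((2 : ℝ)⁻¹) ^ Z = Real.exp (-(Z * Real.log 2)) := by
          rw [Real.exp_neg, Real.exp_nat_mul, Real.exp_log (by norm_num), inv_pow]
        rw [h2, ← Real.exp_add]
        apply Real.exp_le_exp.2
        have h3 : (Z : ℝ) * Real.log 2 ≤ (g * q / 2) * Real.log 2 :=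
          mul_le_mul_of_nonneg_right hω.le (Real.log_nonneg (by norm_num))
        linarith
      · intro s hs
        simp only [f]
        rw [if_neg (Finset.mem_range.1 hs).ne]
    · rw [← Real.exp_neg]
      apply Real.exp_le_exp.2
      have h1 : D ≤ g * q := by
        refine (hD (by omega)).trans ?_
        rw [hq, div_eq_mul_one_div]
        have : (1 : ℝ) ≤ 2 ^ j := one_le_pow₀ (by norm_num)
        gcongr
      -- The constant 3/20 is just below (1 - log 2)/2.
      have h2 := Real.log_two_lt_d9
      have h3 : 0 ≤ g * q := by positivity
      nlinarith
  -- In the last phase all uncorrupted peers succeed, at least g of them, so nothing can fail. This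
  -- also covers b = 0.
  · have hempty : {ω | ¬ EnoughVotes θ A ω t} = ∅ := by
      rw [Set.eq_empty_iff_forall_notMem]
      intro ω hω
      apply hω
      rw [EnoughVotes, ← hj, heq, hθ, Nat.ceil_le]
      simp only [coin_self, and_true]
      have h1 := hgood (history ω t)
      rw [div_self (by positivity)]
      linarith
    rw [hempty]
    simp

/-- The number of queries is dominated by an exponential supermartingale, which the bound on the
sum of the query rates turns into a tail bound. -/
theorem tapeMeasure_queries_gt_le {θ : ℕ → ℕ} (X : Fin n → Bool) (A : Adversary k b β) {K : ℝ}
    (hK : 0 ≤ K) (hθ : ∀ j < b, 2 * (2 ^ (j + 1) / 2 ^ b) ≤ K * θ j) (p : Fin k) (x : ℝ) :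
    tapeMeasure k b {ω | p ∉ A.faulty ω (n * (b + 1)) ∧
        x < ((votingProtocol n k b θ).run X A ω (n * (b + 1))).queries p} ≤
      ENNReal.ofReal (Real.exp (n / 2 ^ b + K * k - x * Real.log 2)) := by
  -- Padding a finite history by an arbitrary tape exhibits the state as a function of the history.
  let ext : (t : ℕ) → (Fin t → RoundBits k b) → Tape k b := fun t h s =>
    if hs : s < t then h ⟨s, hs⟩ else fun _ _ => false
  have hext : ∀ (ω : Tape k b) t, voteStateAt θ X A (ext t (history ω t)) t p =
      voteStateAt θ X A ω t p := by
    intro ω t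
    refine congrArg (fun c : Config n k (VoteState n k) => c.state p)
      (Protocol.run_congr (votingProtocol n k b θ) X A fun s hs => ?_)
    exact dif_pos hs
  -- Two to the number of queries of this round; its conditional mean is 1 + rate ≤ exp(rate).
  let w : VoteState n k → (Fin b → Bool) → ℝ := fun s r =>
    if s.known = none ∧ s.toss b r = true then 2 else 1
  have hw1 : ∀ s r, 1 ≤ w s r := fun s r => by simp only [w]; split_ifs <;> norm_num
  let f : (t : ℕ) → (Fin t → RoundBits k b) → RoundBits k b → ℝ := fun t h r =>
    w (voteStateAt θ X A (ext t h) t p) (r p) *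
      Real.exp (-(voteStateAt θ X A (ext t h) t p).queryRate b)
  have hf0 : ∀ s h r, 0 ≤ f s h r := fun s h r =>
    mul_nonneg (zero_le_one.trans (hw1 _ _)) (Real.exp_pos _).le
  have hmean : ∀ s : VoteState n k, ∑ x, w s x = 2 ^ b * (1 + s.queryRate b) := by
    intro s
    have hjb : s.time % (b + 1) ≤ b := Nat.lt_succ_iff.1 (Nat.mod_lt _ (Nat.succ_pos b))
    by_cases hk : s.known = none
    · simp only [w, hk, true_and, VoteState.toss, VoteState.queryRate, if_true]
      have := sum_coin hjb 1
      norm_num at this ⊢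
      exact this
    · simp [w, hk, VoteState.queryRate]
  have hf : ∀ t h, ∑ r, f t h r ≤ Fintype.card (RoundBits k b) := by
    intro t h
    simp only [f]
    rw [← Finset.sum_mul]
    set s := voteStateAt θ X A (ext t h) t p
    have h1 := sum_roundBits_prod_le (fun q x => if q = p then w s x else 1)
      (fun q => if q = p then 1 + s.queryRate b else 1)
      (fun q x => by split_ifs; exacts [zero_le_one.trans (hw1 _ _), zero_le_one])
      (fun q => by
        split_ifs
        · rw [hmean]
        · simp)
    simp only [Finset.prod_ite_eq', Finset.mem_univ, if_true] at h1
    calc _ ≤ Fintype.card (RoundBits k b) * (1 + s.queryRate b) * Real.exp (-s.queryRate b) :=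
          mul_le_mul_of_nonneg_right h1 (Real.exp_pos _).le
      _ ≤ Fintype.card (RoundBits k b) * Real.exp (s.queryRate b) * Real.exp (-s.queryRate b) := by
          gcongr
          linarith [Real.add_one_le_exp (s.queryRate b)]
      _ = _ := by rw [mul_assoc, ← Real.exp_add]; simp
  have hqueries : ∀ (ω : Tape k b) t,
      (2 : ℝ) ^ (((votingProtocol n k b θ).run X A ω t).queries p) ≤
        ∏ s ∈ Finset.range t, w (voteStateAt θ X A ω s p) (ω s p) := by
    intro ω t
    induction t with
    | zero => simp [Protocol.run]
    | succ t ih =>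
      rw [Finset.prod_range_succ]
      change (2 : ℝ) ^ (_ + ((votingProtocol n k b θ).queriesOf p _ _).card) ≤ _
      rw [pow_add]
      refine mul_le_mul ih ?_ (by positivity)
        (Finset.prod_nonneg fun s _ => zero_le_one.trans (hw1 _ _))
      unfold Protocol.queriesOf
      split_ifs
      · simpa using hw1 _ _
      · refine (pow_le_pow_right₀ one_le_two
          (VoteState.card_query_le b (voteStateAt θ X A ω t p) (ω t p))).trans ?_
        simp only [w]
        split_ifs <;> simp
  refine (MeasureTheory.measure_mono fun ω hω => ?_).trans
    ((tapeMeasure_le_prod_le f hf0 hf (n * (b + 1))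
      (Real.exp_pos (-(n / 2 ^ b + K * k - x * Real.log 2)))).trans
        (by rw [← Real.exp_neg, neg_neg]))
  obtain ⟨hp, hx⟩ := hω
  have h1 := sum_queryRate_le (X := X) hK hθ hp
  rw [Set.mem_ofPred_eq]
  simp only [f, hext]
  rw [Finset.prod_mul_distrib, ← Real.exp_sum, Finset.sum_neg_distrib]
  calc Real.exp (-(n / 2 ^ b + K * k - x * Real.log 2))
      = Real.exp (x * Real.log 2) * Real.exp (-(n / 2 ^ b + K * k)) := by
        rw [← Real.exp_add]; ring_nf
    _ ≤ _ := by
        refine mul_le_mul (le_trans ?_ (hqueries ω _)) (Real.exp_le_exp.2 (by linarith))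
          (Real.exp_pos _).le (Finset.prod_nonneg fun s _ => zero_le_one.trans (hw1 _ _))
        rw [← Real.exp_log (zero_lt_two (α := ℝ)), ← Real.exp_nat_mul,
          Real.exp_log (zero_lt_two (α := ℝ))]
        apply Real.exp_le_exp.2
        gcongr

/-- An execution in which all rounds have enough votes and no nonfaulty peer makes too many queries
is successful. -/
theorem downloadsWithin_votingProtocol {θ : ℕ → ℕ} {X : Fin n → Bool} {A : Adversary k b β}
    {ω : Tape k b} (hβ : β < 1) (hk : 0 < k)
    (hvotes : ∀ t < n * (b + 1), EnoughVotes θ A ω t) {Q T M : ℝ}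
    (hQ : ∀ p ∉ A.faulty ω (n * (b + 1)),
      (((votingProtocol n k b θ).run X A ω (n * (b + 1))).queries p : ℝ) ≤ Q)
    (hT : (n : ℝ) * (b + 1) ≤ T) (hM : (n : ℝ) * (k : ℝ) ^ 2 ≤ M) :
    (votingProtocol n k b θ).DownloadsWithin X A ω Q T M := by
  have hout : ∀ p ∉ A.faulty ω (n * (b + 1)), (votingProtocol n k b θ).output
      (((votingProtocol n k b θ).run X A ω (n * (b + 1))).state p) = some X := by
    intro p hp
    have hS := sound_of_enoughVotes (X := X) le_rfl hvotes p hp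
    have htime := voteStateAt_time (θ := θ) (X := X) le_rfl hp
    have hval : (voteStateAt θ X A ω (n * (b + 1)) p).value = X := funext fun i =>
      hS.value i (by rw [Nat.mul_div_cancel _ (Nat.succ_pos b)]; exact i.2)
    exact (if_pos htime.ge).trans (congrArg some hval)
  refine ⟨n * (b + 1), ⟨fun p hp => ?_, fun t ht => ?_⟩, hout, hQ, by push_cast; exact hT,
    le_trans ?_ hM⟩
  · rw [hout p hp]; rfl
  · by_contra! hlt
    obtain ⟨p, hp⟩ := A.exists_notMem_faulty ω hβ hk t
    have h1 := ht p hp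
    have htime := voteStateAt_time (θ := θ) (X := X) hlt.le hp
    have h2 : (votingProtocol n k b θ).output
        (((votingProtocol n k b θ).run X A ω t).state p) = none :=
      if_neg (by rw [not_le]; exact htime.trans_lt hlt)
    rw [h2] at h1
    simp at h1
  · have hsum : ∑ p ∈ (A.faulty ω (n * (b + 1)))ᶜ,
        ((votingProtocol n k b θ).run X A ω (n * (b + 1))).messages p ≤ n * k ^ 2 := by
      calc _ ≤ ∑ _p ∈ (A.faulty ω (n * (b + 1)))ᶜ, k * n := by
            refine Finset.sum_le_sum fun p hp => ?_
            obtain ⟨h1, h2⟩ := messages_le (θ := θ) (X := X) le_rfl (Finset.mem_compl.1 hp)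
            rw [h2 (Nat.mul_mod_left _ _), Nat.mul_div_cancel _ (Nat.succ_pos b)] at h1
            simpa using h1
        _ ≤ k * (k * n) := by
            rw [Finset.sum_const, smul_eq_mul]
            exact Nat.mul_le_mul_right _ ((Finset.card_le_univ _).trans (by simp))
        _ = _ := by ring
    exact_mod_cast hsum

/-- A union bound over all rounds and all k peers, since which peers stay nonfaulty is itself
random. -/
theorem tapeMeasure_not_downloadsWithin_le {θ : ℕ → ℕ} {X : Fin n → Bool}
    {A : Adversary k b β} (hβ : β < 1) (hk : 0 < k) {Q T M : ℝ} {δ ε : ENNReal}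
    (hvotes : ∀ t, tapeMeasure k b {ω | ¬ EnoughVotes θ A ω t} ≤ δ)
    (hqueries : ∀ p, tapeMeasure k b {ω | p ∉ A.faulty ω (n * (b + 1)) ∧
      Q < ((votingProtocol n k b θ).run X A ω (n * (b + 1))).queries p} ≤ ε)
    (hT : (n : ℝ) * (b + 1) ≤ T) (hM : (n : ℝ) * (k : ℝ) ^ 2 ≤ M) :
    tapeMeasure k b {ω | ¬ (votingProtocol n k b θ).DownloadsWithin X A ω Q T M} ≤
      (n * (b + 1) : ℕ) * δ + k * ε := by
  have hsub : {ω : Tape k b | ¬ (votingProtocol n k b θ).DownloadsWithin X A ω Q T M} ⊆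
      (⋃ t ∈ Finset.range (n * (b + 1)), {ω : Tape k b | ¬ EnoughVotes θ A ω t}) ∪
      ⋃ p ∈ (Finset.univ : Finset (Fin k)), {ω : Tape k b | p ∉ A.faulty ω (n * (b + 1)) ∧
        Q < ((votingProtocol n k b θ).run X A ω (n * (b + 1))).queries p} := by
    intro ω hω
    by_contra hnot
    rw [Set.mem_union, not_or] at hnot
    refine hω (downloadsWithin_votingProtocol hβ hk (fun t ht => ?_) (fun p hp => ?_) hT hM)
    · by_contra h
      exact hnot.1 (Set.mem_biUnion (Finset.mem_coe.2 (Finset.mem_range.2 ht)) h)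
    · by_contra! h
      exact hnot.2 (Set.mem_biUnion (Finset.mem_coe.2 (Finset.mem_univ p)) ⟨hp, h⟩)
  calc _ ≤ _ := MeasureTheory.measure_mono hsub
    _ ≤ (∑ _t ∈ Finset.range (n * (b + 1)), δ) + ∑ _p : Fin k, ε :=
      (MeasureTheory.measure_union_le _ _).trans (add_le_add
        ((MeasureTheory.measure_biUnion_finset_le _ _).trans
          (Finset.sum_le_sum fun t _ => hvotes t))
        ((MeasureTheory.measure_biUnion_finset_le _ _).trans
          (Finset.sum_le_sum fun p _ => hqueries p)))
    _ = _ := by simp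

/-- Take the largest `b` with `2 ^ b ≤ y`, and `0` if `y < 1`. -/
theorem exists_pow_two_le_lt (y : ℝ) :
    ∃ b : ℕ, y < 2 ^ (b + 1) ∧ (0 < b → (2 : ℝ) ^ b ≤ y) := by
  refine ⟨Nat.log 2 ⌊y⌋₊, ?_, fun hb => ?_⟩
  · have h1 := Nat.lt_pow_succ_log_self one_lt_two ⌊y⌋₊
    have h2 : ((⌊y⌋₊ : ℝ) + 1) ≤ 2 ^ (Nat.log 2 ⌊y⌋₊ + 1) := by exact_mod_cast h1
    exact (Nat.lt_floor_add_one y).trans_le h2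
  · have h0 : ⌊y⌋₊ ≠ 0 := by rintro h; simp [h] at hb
    have h1 : ((2 : ℝ) ^ Nat.log 2 ⌊y⌋₊) ≤ ⌊y⌋₊ := by exact_mod_cast Nat.pow_log_le_self 2 h0
    exact h1.trans (Nat.floor_le (by by_contra! hy; exact h0 (Nat.floor_of_nonpos hy.le)))

end DataRetrieval

end

/-! ### Choice of parameters -/

theorem mainTheorem1 :
    ∃ S : ℕ, ∀ c : ℝ, 1 ≤ c → ∃ C : ℝ, 0 < C ∧
      ∀ (n k : ℕ) (β : ℝ), 2 ≤ k → k ≤ n → 0 ≤ β → β < 1 →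
        ∃ P : DataRetrieval.Protocol n k,
          ∀ (X : Fin n → Bool) (A : DataRetrieval.Adversary k P.bits β),
            P.MessageSizeAtMost X A S ∧
            DataRetrieval.tapeMeasure k P.bits
              {ω | ¬ P.DownloadsWithin X A ω
                (C * (n * Real.logb 2 n / ((1 - β) * k)))
                (C * (n * Real.logb 2 k))
                (C * (n * (k : ℝ) ^ 2))} ≤ ENNReal.ofReal ((n : ℝ) ^ (-c)) := by
  open DataRetrieval in
  refine ⟨1, fun c hc => ⟨20 * (c + 4), by linarith, fun n k β hk hkn hβ0 hβ1 => ?_⟩⟩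
  have hkR : (2 : ℝ) ≤ k := by exact_mod_cast hk
  have hknR : (k : ℝ) ≤ n := by exact_mod_cast hkn
  have hn : (0 : ℝ) < n := by linarith
  set L := Real.log n with hL
  have hlog2 := Real.log_two_gt_d9
  have hL2 : Real.log 2 ≤ L := Real.log_le_log (by norm_num) (hkR.trans hknR)
  set g : ℝ := (1 - β) * k with hg
  have hg0 : 0 < g := mul_pos (by linarith) (by linarith)
  have hgk : g ≤ k := by nlinarith
  -- Since 7 · 3/20 > 1, each round fails with probability at most n^(-(c+4)).
  set D : ℝ := 7 * (c + 4) * L with hD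
  have hD1 : 1 ≤ D := by nlinarith
  obtain ⟨b, hb1, hb2⟩ := exists_pow_two_le_lt (g / D)
  have hpow : (2 : ℝ) ^ b ≤ k := by
    rcases Nat.eq_zero_or_pos b with h0 | h0
    · rw [h0]; norm_num; linarith
    · exact (hb2 h0).trans ((div_le_self hg0.le hD1).trans hgk)
  have hbk : b + 1 ≤ k := by
    have h1 : 2 ^ b ≤ k := by exact_mod_cast hpow
    exact Nat.succ_le_of_lt (Nat.lt_two_pow_self.trans_le h1)
  have hblog : (b : ℝ) + 1 ≤ 2 * Real.logb 2 k := by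
    have h1 : (b : ℝ) ≤ Real.logb 2 k := by
      rw [Real.le_logb_iff_rpow_le (by norm_num) (by linarith), Real.rpow_natCast]
      exact hpow
    have h2 : (1 : ℝ) ≤ Real.logb 2 k := by
      rw [Real.le_logb_iff_rpow_le (by norm_num) (by linarith), Real.rpow_one]
      exact hkR
    linarith
  let θ : ℕ → ℕ := fun j => ⌈g * (2 ^ j / 2 ^ b) / 2⌉₊
  have hDg : 0 < b → D ≤ g / 2 ^ b := by
    intro h0
    rw [le_div_iff₀ (by positivity), mul_comm, ← le_div_iff₀ (by linarith)]
    exact hb2 h0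
  have hθ : ∀ j < b, 2 * (2 ^ (j + 1) / 2 ^ b) ≤ 8 / g * θ j := by
    intro j _
    calc (2 : ℝ) * (2 ^ (j + 1) / 2 ^ b) = 8 / g * (g * (2 ^ j / 2 ^ b) / 2) := by
          field_simp; ring
      _ ≤ _ := mul_le_mul_of_nonneg_left (Nat.le_ceil _) (by positivity)
  suffices hmain : ∀ (X : Fin n → Bool) (A : Adversary k b β),
      tapeMeasure k b {ω | ¬ (votingProtocol n k b θ).DownloadsWithin X A ω
        (20 * (c + 4) * (n * Real.logb 2 n / g)) (20 * (c + 4) * (n * Real.logb 2 k))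
        (20 * (c + 4) * (n * (k : ℝ) ^ 2))} ≤ ENNReal.ofReal ((n : ℝ) ^ (-c)) from
    ⟨votingProtocol n k b θ, fun X A => ⟨messageSizeAtMost_votingProtocol θ X A, hmain X A⟩⟩
  intro X A
  -- The number of queries at which the tail bound equals n^(-(c+2)).
  set x : ℝ := (n / 2 ^ b + 8 / g * k + (c + 2) * L) / Real.log 2 with hx
  have hxC : x ≤ 20 * (c + 4) * (n * Real.logb 2 n / g) := by
    have h1 : 1 / (2 : ℝ) ^ b ≤ 2 * D / g := by
      rw [div_lt_iff₀ (by linarith), pow_succ] at hb1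
      rw [div_le_div_iff₀ (by positivity) hg0]
      linarith
    have h2 : (n : ℝ) / 2 ^ b ≤ 14 * (c + 4) * (n * L / g) := by
      calc (n : ℝ) / 2 ^ b = n * (1 / 2 ^ b) := by ring
        _ ≤ n * (2 * D / g) := by gcongr
        _ = _ := by rw [hD]; ring
    have h3 : 8 / g * k ≤ 16 * (n * L / g) := by
      rw [div_mul_eq_mul_div, ← mul_div_assoc]
      refine div_le_div_of_nonneg_right ?_ hg0.le
      nlinarith
    have h4 : L ≤ n * L / g := by
      rw [le_div_iff₀ hg0]
      nlinarith
    have h5 : (c + 2) * L ≤ (c + 2) * (n * L / g) := by gcongr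
    have h6 : 0 ≤ n * L / g := by
      have : 0 ≤ L := by linarith
      positivity
    rw [hx, div_le_iff₀ (by linarith), Real.logb, ← hL]
    have h7 : 20 * (c + 4) * (n * (L / Real.log 2) / g) * Real.log 2 =
        20 * (c + 4) * (n * L / g) := by
      have : Real.log 2 ≠ 0 := by linarith
      field_simp
    rw [h7]
    -- The three terms sum to 14(c+4) + 16 + (c+2) ≤ 20(c+4) times nL/g.
    nlinarith
  have hexp : ∀ a : ℝ, (n : ℝ) ^ a = Real.exp (L * a) := fun a => Real.rpow_def_of_pos hn a
  have hround : ∀ t, tapeMeasure k b {ω | ¬ EnoughVotes θ A ω t} ≤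
      ENNReal.ofReal ((n : ℝ) ^ (-(c + 4))) := fun t =>
    (tapeMeasure_not_enoughVotes_le A hβ1 (fun j => rfl) hDg t).trans
      (ENNReal.ofReal_le_ofReal (by
        rw [hexp]
        apply Real.exp_le_exp.2
        rw [hD]
        nlinarith))
  have hpeer : ∀ p, tapeMeasure k b {ω | p ∉ A.faulty ω (n * (b + 1)) ∧
      20 * (c + 4) * (n * Real.logb 2 n / g) <
        ((votingProtocol n k b θ).run X A ω (n * (b + 1))).queries p} ≤
      ENNReal.ofReal ((n : ℝ) ^ (-(c + 2))) := fun p =>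
    (tapeMeasure_queries_gt_le X A (by positivity) hθ p _).trans
      (ENNReal.ofReal_le_ofReal (by
        rw [hexp]
        apply Real.exp_le_exp.2
        have h1 := mul_le_mul_of_nonneg_right hxC (by linarith : 0 ≤ Real.log 2)
        rw [hx, div_mul_cancel₀ _ (by linarith)] at h1
        linarith))
  have hT : (n : ℝ) * (b + 1) ≤ 20 * (c + 4) * (n * Real.logb 2 k) := by
    calc (n : ℝ) * (b + 1) ≤ n * (2 * Real.logb 2 k) := by gcongr
      _ = 2 * (n * Real.logb 2 k) := by ring
      _ ≤ _ := by
        have : 0 ≤ Real.logb 2 k := Real.logb_nonneg (by norm_num) (by linarith)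
        gcongr
        linarith
  have hM : (n : ℝ) * (k : ℝ) ^ 2 ≤ 20 * (c + 4) * (n * (k : ℝ) ^ 2) :=
    le_mul_of_one_le_left (by positivity) (by linarith)
  calc _ ≤ _ := tapeMeasure_not_downloadsWithin_le hβ1 (by omega) hround hpeer hT hM
    _ = ENNReal.ofReal ((n * (b + 1) : ℕ) * (n : ℝ) ^ (-(c + 4)) + k * (n : ℝ) ^ (-(c + 2))) := by
      rw [ENNReal.ofReal_add (by positivity) (by positivity), ENNReal.ofReal_mul (by positivity),
        ENNReal.ofReal_mul (by positivity), ENNReal.ofReal_natCast, ENNReal.ofReal_natCast]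
    _ ≤ _ := by
      apply ENNReal.ofReal_le_ofReal
      have e1 : (n : ℝ) ^ (-(c + 2)) = n ^ 2 * (n : ℝ) ^ (-(c + 4)) := by
        rw [← Real.rpow_natCast, ← Real.rpow_add hn]; congr 1; push_cast; ring
      have e2 : (n : ℝ) ^ (-c) = n ^ 2 * (n : ℝ) ^ (-(c + 2)) := by
        rw [← Real.rpow_natCast, ← Real.rpow_add hn]; congr 1; push_cast; ring
      have h1 : ((n * (b + 1) : ℕ) : ℝ) ≤ n ^ 2 := by
        have : n * (b + 1) ≤ n ^ 2 := by rw [sq]; exact Nat.mul_le_mul_left _ (hbk.trans hkn)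
        exact_mod_cast this
      have h2 : (0 : ℝ) ≤ (n : ℝ) ^ (-(c + 4)) := by positivity
      have h3 : (0 : ℝ) ≤ (n : ℝ) ^ (-(c + 2)) := by positivity
      have h4 := mul_le_mul_of_nonneg_right h1 h2
      rw [← e1] at h4
      -- With n(b+1) ≤ n^2, the total failure probability is at most (1 + k) n^(-(c+2)).
      have h5 : (1 : ℝ) + k ≤ n ^ 2 := by nlinarith
      rw [e2]
      nlinarith
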